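/- (Compactness Lemma.) Let $d\ge 2$ be an integer and let $\sigma>0$ be a real number in the $H^2$-subcritical range, that is, $\sigma>0$ is arbitrary if $d\le 4$, and $0<\sigma<\frac{4}{d-4}$ if $d>4$. Let $H^2_{\rm radial}(\mathbb{R}^d)$ be the space of complex-valued functions $u$ in the Sobolev space $H^2(\mathbb{R}^d)$ that are radial, i.e. $u(x)$ depends (almost everywhere) only on $|x|$, with the norm $$\|u\|_{H^2}=\Big(\|u\|_{L^2}^2+\sum_{i}\|\partial_i u\|_{L^2}^2+\sum_{i,j}\|\partial_i\partial_j u\|_{L^2}^2\Big)^{1/2}.$$ Then the embedding $$H^2_{\rm radial}(\mathbb{R}^d)\to L^{2(\sigma+1)}(\mathbb{R}^d)$$ is compact. That is, $H^2_{\rm radial}(\mathbb{R}^d)\subset L^{2(\sigma+1)}(\mathbb{R}^d)$, there is a constant $C=C(d,\sigma)$ with $\|u\|_{L^{2(\sigma+1)}}\le C\|u\|_{H^2}$ for all $u\in H^2_{\rm radial}(\mathbb{R}^d)$, and every sequence that is bounded in $H^2_{\rm radial}(\mathbb{R}^d)$ has a subsequence which converges strongly in $L^{2(\sigma+1)}(\mathbb{R}^d)$.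 -/

import Mathlib

open MeasureTheory Filter Topology
open scoped ENNReal NNReal SchwartzMap LineDeriv

/-- The `L²` norm of a tempered distribution on `ℝ^d`: the norm of the `L²` function that represents
it (this function is unique), and `∞` if there is no such function. -/
noncomputable def distL2Norm {d : ℕ} (T : 𝓢'(EuclideanSpace ℝ (Fin d), ℂ)) : ℝ≥0∞ :=
  ⨅ (f : Lp ℂ 2 (volume : Measure (EuclideanSpace ℝ (Fin d))))
    (_ : T = (f : 𝓢'(EuclideanSpace ℝ (Fin d), ℂ))), eLpNorm f 2 volume

/-- The `H²` norm of a function `u ∈ L²(ℝ^d; ℂ)`,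
`(‖u‖₂² + ∑ i, ‖∂ᵢ u‖₂² + ∑ i j, ‖∂ᵢ ∂ⱼ u‖₂²) ^ (1/2)`, with distributional derivatives. It is `∞`
if one of the derivatives of order at most two is not an `L²` function. -/
noncomputable def h2Norm {d : ℕ}
    (u : Lp ℂ 2 (volume : Measure (EuclideanSpace ℝ (Fin d)))) : ℝ≥0∞ :=
  (eLpNorm u 2 volume ^ 2
    + ∑ i : Fin d, distL2Norm
        (∂_{EuclideanSpace.single i (1 : ℝ)} (u : 𝓢'(EuclideanSpace ℝ (Fin d), ℂ))) ^ 2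
    + ∑ i : Fin d, ∑ j : Fin d, distL2Norm
        (∂_{EuclideanSpace.single i (1 : ℝ)} (∂_{EuclideanSpace.single j (1 : ℝ)}
          (u : 𝓢'(EuclideanSpace ℝ (Fin d), ℂ)))) ^ 2) ^ (1 / 2 : ℝ)

/-- `u` is (almost everywhere) a function of `r = ‖x‖` alone. -/
def IsRadial {d : ℕ} (u : EuclideanSpace ℝ (Fin d) → ℂ) : Prop :=
  ∃ g : ℝ → ℂ, u =ᵐ[volume] fun x => g ‖x‖

/-- The space `H²_radial(ℝ^d)` of radial complex-valued functions in the Sobolev space `H²(ℝ^d)`. -/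
def H2Radial (d : ℕ) : Set (Lp ℂ 2 (volume : Measure (EuclideanSpace ℝ (Fin d)))) :=
  {u | h2Norm u < ∞ ∧ IsRadial u}

/-- The `H²`-subcritical range of exponents: `0 < σ`, and `σ < 4 / (d - 4)` if `d > 4`. -/
def H2Subcritical (d : ℕ) (σ : ℝ) : Prop :=
  0 < σ ∧ (4 < d → σ < 4 / ((d : ℝ) - 4))

/-! Put `p = 2 * (σ + 1)` and split `u` in frequency at radius `2 ^ k`. The high frequencies are
uniformly small in `L^p`: the dyadic shell at `2 ^ j` has `L²` norm `O(4 ^ (-j))` by Plancherel, and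
its sup norm exceeds this bound by at most the square root of the shell's volume. Interpolation
gives a geometric series of ratio `2 ^ (d * (1/2 - 1/p) - 2)`, which is below one exactly in the
subcritical range (`eLpNorm_band_shell_le`, `dyadic_ratio_lt_one`). Adding the frequencies in the
unit ball yields the Sobolev inequality, without radiality.

The low frequencies are radial, bounded in `L²` and equi-Lipschitz. Radiality prevents escape to
infinity: a large value at `x` persists on a shell whose volume grows with `‖x‖` because `d ≥ 2`,
against the `L²` bound (`exists_radius_norm_le`). Evaluating the low-frequency part at a point is a
bounded functional of `u`, so weak `L²` compactness gives pointwise convergence along a subsequence.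
Equicontinuity and decay make it uniform, and interpolation with `L²` turns it into `L^p`
convergence (`tendsto_eLpNorm_band_sub_band`). -/

open scoped FourierTransform

/-! ### The Fourier transform on `L²`: distributions, integrals, isometries -/

section FourierL2

variable {E : Type*} [NormedAddCommGroup E] [InnerProductSpace ℝ E] [FiniteDimensional ℝ E]
  [MeasurableSpace E] [BorelSpace E]

/-- Two locally integrable functions that agree as distributions agree almost everywhere. -/
theorem ae_eq_of_integral_schwartz_smul_eq {f g : E → ℂ}
    (hf : LocallyIntegrable f volume) (hg : LocallyIntegrable g volume)
    (h : ∀ φ : 𝓢(E, ℂ), ∫ x, φ x • f x = ∫ x, φ x • g x) : f =ᵐ[volume] g := by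
  refine ae_eq_of_integral_contDiff_smul_eq hf hg fun φ hφ hc => ?_
  have h₁ : HasCompactSupport (Complex.ofRealCLM ∘ φ) := hc.comp_left rfl
  have h₂ : ContDiff ℝ ((⊤ : ℕ∞) : WithTop ℕ∞) (Complex.ofRealCLM ∘ φ) := by fun_prop
  simpa using h (h₁.toSchwartzMap h₂)

theorem integral_schwartz_smul_fourierInv_eq (φ : 𝓢(E, ℂ)) {g : E → ℂ}
    (hg : Integrable g volume) :
    ∫ x, φ x • (𝓕⁻ g) x = ∫ x, (𝓕⁻ φ : 𝓢(E, ℂ)) x • g x := by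
  -- The sign in `-innerₗ E` turns the forward transform into the inverse one.
  have := VectorFourier.integral_fourierIntegral_smul_eq_flip (e := Real.fourierChar)
    (μ := (volume : Measure E)) (ν := (volume : Measure E)) (L := -innerₗ E)
    Real.continuous_fourierChar (by simpa using by fun_prop) φ.integrable hg
  rw [SchwartzMap.fourierInv_coe]
  convert! this.symm using 3 with x
  simp [Real.fourierInv_eq, VectorFourier.fourierIntegral, real_inner_comm]

theorem continuous_fourierInv_of_integrable {g : E → ℂ} (hg : Integrable g volume) :
    Continuous (𝓕⁻ g) :=
  VectorFourier.fourierIntegral_continuous Real.continuous_fourierChar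
    (by simpa using by fun_prop) hg

/-- On `L¹ ∩ L²` the inverse Fourier integral represents the inverse `L²` Fourier transform. -/
theorem coeFn_fourierInv_toLp_ae_eq {g : E → ℂ} (h1 : Integrable g volume)
    (h2 : MemLp g 2 volume) :
    (𝓕⁻ (h2.toLp g) : Lp ℂ 2 (volume : Measure E)) =ᵐ[volume] 𝓕⁻ g := by
  refine ae_eq_of_integral_schwartz_smul_eq
    ((Lp.memLp _).locallyIntegrable one_le_two)
    (continuous_fourierInv_of_integrable h1).locallyIntegrable fun φ => ?_
  rw [← Lp.toTemperedDistribution_apply, ← Lp.fourierInv_toTemperedDistribution_eq,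
    TemperedDistribution.fourierInv_apply, Lp.toTemperedDistribution_apply,
    integral_schwartz_smul_fourierInv_eq φ h1]
  refine integral_congr_ae ?_
  filter_upwards [h2.coeFn_toLp] with x hx
  rw [hx]

/-- A second derivative becomes multiplication by a quadratic monomial on the Fourier side. -/
theorem fourier_ae_eq_of_lineDerivOp_lineDerivOp_eq {u f : Lp ℂ 2 (volume : Measure E)} {m : E}
    (h : ∂_{m} (∂_{m} (u : 𝓢'(E, ℂ))) = (f : 𝓢'(E, ℂ))) :
    (𝓕 f : Lp ℂ 2 (volume : Measure E)) =ᵐ[volume]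
      fun ξ => (-(2 * Real.pi * inner ℝ ξ m) ^ 2 : ℝ) •
        (𝓕 u : Lp ℂ 2 (volume : Measure E)) ξ := by
  have hm : (fun ξ : E => ((inner ℝ ξ m : ℝ) : ℂ)).HasTemperateGrowth := by fun_prop
  refine ae_eq_of_integral_schwartz_smul_eq
    ((Lp.memLp _).locallyIntegrable one_le_two) ?_ fun φ => ?_
  · exact LocallyIntegrable.continuous_smul (by fun_prop)
      ((Lp.memLp _).locallyIntegrable one_le_two)
  · rw [← Lp.toTemperedDistribution_apply, ← Lp.fourier_toTemperedDistribution_eq, ← h,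
      TemperedDistribution.fourier_lineDerivOp_eq, TemperedDistribution.fourier_lineDerivOp_eq,
      Lp.fourier_toTemperedDistribution_eq, map_smul]
    change (2 * Real.pi * Complex.I) * ((2 * Real.pi * Complex.I) *
      (Lp.toTemperedDistribution (𝓕 u) (SchwartzMap.smulLeftCLM ℂ _
        (SchwartzMap.smulLeftCLM ℂ _ φ)))) = _
    rw [Lp.toTemperedDistribution_apply]
    simp only [smul_eq_mul]
    rw [← integral_const_mul, ← integral_const_mul]
    refine integral_congr_ae (.of_forall fun ξ => ?_)
    simp only [SchwartzMap.smulLeftCLM_apply_apply hm, smul_eq_mul, Complex.real_smul]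
    push_cast
    linear_combination (-4 * Real.pi ^ 2 * (inner ℝ ξ m : ℂ) ^ 2 * φ ξ *
       (𝓕 u : Lp ℂ 2 (volume : Measure E)) ξ * (-1)) * Complex.I_sq

/-- A change of variables for Schwartz functions, extended by density. It is what makes frequency
truncation to balls preserve radiality. -/
theorem fourier_compMeasurePreserving (R : E ≃ₗᵢ[ℝ] E) (u : Lp ℂ 2 (volume : Measure E)) :
    𝓕 (Lp.compMeasurePreserving R R.measurePreserving u) =
      Lp.compMeasurePreserving R R.measurePreserving (𝓕 u) := by
  let c := Lp.compMeasurePreservingₗᵢ (E := ℂ) (p := 2) ℂ R R.measurePreserving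
  change 𝓕 (c u) = c (𝓕 u)
  refine DenseRange.induction_on
    (p := fun u : Lp ℂ 2 (volume : Measure E) => 𝓕 (c u) = c (𝓕 u))
    (SchwartzMap.denseRange_toLpCLM (p := 2) ENNReal.ofNat_ne_top) u ?_ fun φ => ?_
  · exact isClosed_eq ((Lp.fourierTransformₗᵢ E ℂ).continuous.comp c.continuous)
      (c.continuous.comp (Lp.fourierTransformₗᵢ E ℂ).continuous)
  · have key : ∀ ψ : 𝓢(E, ℂ), c (ψ.toLp 2) =
        (SchwartzMap.compCLMOfContinuousLinearEquiv ℂ R.toContinuousLinearEquiv ψ).toLp 2 := by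
      intro ψ
      apply Lp.ext
      refine (Lp.coeFn_compMeasurePreserving _ R.measurePreserving).trans ?_
      refine (R.measurePreserving.quasiMeasurePreserving.ae_eq_comp
        (ψ.coeFn_toLp 2 volume)).trans ?_
      refine .trans (.of_forall fun x => ?_) (SchwartzMap.coeFn_toLp _ 2 volume).symm
      simp
    rw [SchwartzMap.toLpCLM_apply, key, SchwartzMap.toLp_fourier_eq, SchwartzMap.toLp_fourier_eq,
      key]
    congr 1
    ext ξ
    simp only [SchwartzMap.fourier_coe, SchwartzMap.compCLMOfContinuousLinearEquiv_apply]
    exact Real.fourier_comp_linearIsometry R φ ξ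

end FourierL2

/-! ### Frequency truncation -/

section Band

variable {E : Type*} [NormedAddCommGroup E] [InnerProductSpace ℝ E] [FiniteDimensional ℝ E]
  [MeasurableSpace E] [BorelSpace E]

/-- The part of `u` with frequencies in `S`. -/
noncomputable def band (S : Set E) (u : Lp ℂ 2 (volume : Measure E)) : E → ℂ :=
  𝓕⁻ (S.indicator (𝓕 u : Lp ℂ 2 (volume : Measure E)))

variable {S T : Set E} (u : Lp ℂ 2 (volume : Measure E))

theorem memLp_indicator_fourier (hS : MeasurableSet S) :
    MemLp (S.indicator (𝓕 u : Lp ℂ 2 (volume : Measure E))) 2 volume :=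
  (Lp.memLp _).indicator hS

/-- Cauchy-Schwarz on `S`; the source of both the sup and the Lipschitz bounds for `band`. -/
theorem eLpNorm_one_indicator_fourier_le (hS : MeasurableSet S) :
    eLpNorm (S.indicator (𝓕 u : Lp ℂ 2 (volume : Measure E))) 1 volume ≤
      eLpNorm (S.indicator (𝓕 u : Lp ℂ 2 (volume : Measure E))) 2 volume *
        volume S ^ (1 / 2 : ℝ) := by
  rw [eLpNorm_indicator_eq_eLpNorm_restrict hS, eLpNorm_indicator_eq_eLpNorm_restrict hS]
  refine (eLpNorm_le_eLpNorm_mul_rpow_measure_univ one_le_two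
    (Lp.aestronglyMeasurable _).restrict).trans_eq ?_
  norm_num

theorem integrable_indicator_fourier (hS : MeasurableSet S) (hS' : volume S ≠ ∞) :
    Integrable (S.indicator (𝓕 u : Lp ℂ 2 (volume : Measure E))) volume := by
  refine memLp_one_iff_integrable.1 ⟨(memLp_indicator_fourier u hS).1, ?_⟩
  exact (eLpNorm_one_indicator_fourier_le u hS).trans_lt
    (ENNReal.mul_lt_top (memLp_indicator_fourier u hS).2 (by finiteness))

theorem band_ae_eq (hS : MeasurableSet S) (hS' : volume S ≠ ∞) :
    (𝓕⁻ ((memLp_indicator_fourier u hS).toLp _) : Lp ℂ 2 (volume : Measure E))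
      =ᵐ[volume] band S u :=
  coeFn_fourierInv_toLp_ae_eq (integrable_indicator_fourier u hS hS') _

theorem continuous_band (hS : MeasurableSet S) (hS' : volume S ≠ ∞) : Continuous (band S u) :=
  continuous_fourierInv_of_integrable (integrable_indicator_fourier u hS hS')

theorem eLpNorm_fourier_eq :
    eLpNorm (𝓕 u : Lp ℂ 2 (volume : Measure E)) 2 volume = eLpNorm u 2 volume := by
  have := Lp.norm_fourier_eq u
  rwa [Lp.norm_def, Lp.norm_def,
    ENNReal.toReal_eq_toReal_iff' (Lp.eLpNorm_ne_top _) (Lp.eLpNorm_ne_top _)] at this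

theorem eLpNorm_fourierInv_eq :
    eLpNorm (𝓕⁻ u : Lp ℂ 2 (volume : Measure E)) 2 volume = eLpNorm u 2 volume := by
  rw [← eLpNorm_fourier_eq, FourierTransform.fourier_fourierInv_eq]

theorem eLpNorm_band (hS : MeasurableSet S) (hS' : volume S ≠ ∞) :
    eLpNorm (band S u) 2 volume =
      eLpNorm (S.indicator (𝓕 u : Lp ℂ 2 (volume : Measure E))) 2 volume := by
  rw [← eLpNorm_congr_ae (band_ae_eq u hS hS'), eLpNorm_fourierInv_eq,
    eLpNorm_congr_ae (MemLp.coeFn_toLp _)]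

theorem eLpNorm_indicator_fourier_le (S : Set E) :
    eLpNorm (S.indicator (𝓕 u : Lp ℂ 2 (volume : Measure E))) 2 volume ≤ eLpNorm u 2 volume :=
  (eLpNorm_indicator_le _).trans_eq (eLpNorm_fourier_eq u)

theorem enorm_band_le (hS : MeasurableSet S) (x : E) :
    ‖band S u x‖ₑ ≤
      eLpNorm (S.indicator (𝓕 u : Lp ℂ 2 (volume : Measure E))) 2 volume *
        volume S ^ (1 / 2 : ℝ) := by
  refine le_trans ?_ (eLpNorm_one_indicator_fourier_le u hS)
  rw [band, Real.fourierInv_eq, eLpNorm_one_eq_lintegral_enorm]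
  refine (enorm_integral_le_lintegral_enorm _).trans_eq (lintegral_congr fun ξ => ?_)
  rw [Circle.smul_def, enorm_smul, ← ofReal_norm (Real.fourierChar _ : ℂ), Circle.norm_coe,
    ENNReal.ofReal_one, one_mul]

theorem integrable_fourierChar_smul {g : E → ℂ} (hg : Integrable g volume) (x : E) :
    Integrable (fun ξ => Real.fourierChar (inner ℝ ξ x) • g ξ) volume := by
  simpa using (Real.fourierIntegral_convergent_iff (-x)).2 hg

theorem band_sub_band (hS : MeasurableSet S) (hT : MeasurableSet T) (hT' : volume T ≠ ∞)
    (hST : S ⊆ T) (x : E) : band T u x - band S u x = band (T \ S) u x := by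
  have hi : ∀ A ⊆ T, MeasurableSet A →
      Integrable (fun ξ => Real.fourierChar (inner ℝ ξ x) •
      A.indicator (𝓕 u : Lp ℂ 2 (volume : Measure E)) ξ) volume := fun A hA hA' =>
    integrable_fourierChar_smul
      (integrable_indicator_fourier u hA' (measure_ne_top_of_subset hA hT')) x
  simp only [band, Real.fourierInv_eq]
  rw [← integral_sub (hi T subset_rfl hT) (hi S hST hS)]
  refine integral_congr_ae (.of_forall fun ξ => ?_)
  by_cases h : ξ ∈ S
  · simp [h, hST h]
  · by_cases h' : ξ ∈ T <;> simp [h, h']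

theorem eLpNorm_sub_band (hS : MeasurableSet S) (hS' : volume S ≠ ∞) :
    eLpNorm (⇑u - band S u) 2 volume =
      eLpNorm (Sᶜ.indicator (𝓕 u : Lp ℂ 2 (volume : Measure E))) 2 volume := by
  have h1 : ⇑u - band S u =ᵐ[volume]
      (u - 𝓕⁻ ((memLp_indicator_fourier u hS).toLp _) : Lp ℂ 2 (volume : Measure E)) := by
    filter_upwards [band_ae_eq u hS hS', Lp.coeFn_sub u
      (𝓕⁻ ((memLp_indicator_fourier u hS).toLp _) : Lp ℂ 2 (volume : Measure E))] with x hx hx'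
    rw [hx', Pi.sub_apply, Pi.sub_apply, hx]
  have h2 : (𝓕 (u - 𝓕⁻ ((memLp_indicator_fourier u hS).toLp _)) : Lp ℂ 2 (volume : Measure E)) =
      𝓕 u - (memLp_indicator_fourier u hS).toLp _ := by
    refine ((Lp.fourierTransformₗᵢ E ℂ).map_sub _ _).trans ?_
    congr 1
    exact FourierTransform.fourier_fourierInv_eq (E := Lp ℂ 2 (volume : Measure E))
      (F := Lp ℂ 2 (volume : Measure E)) _
  rw [eLpNorm_congr_ae h1, ← eLpNorm_fourier_eq, h2]
  refine eLpNorm_congr_ae ?_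
  filter_upwards [Lp.coeFn_sub (𝓕 u : Lp ℂ 2 (volume : Measure E))
    ((memLp_indicator_fourier u hS).toLp _), (memLp_indicator_fourier u hS).coeFn_toLp]
    with ξ h h'
  rw [h, Pi.sub_apply, h']
  by_cases hξ : ξ ∈ S <;> simp [hξ]

theorem norm_fourierChar_sub_le (a b : ℝ) :
    ‖(Real.fourierChar a : ℂ) - Real.fourierChar b‖ ≤ 2 * Real.pi * |a - b| := by
  have h : (Real.fourierChar a : ℂ) - Real.fourierChar b =
      Real.fourierChar b * (Complex.exp (Complex.I * (2 * Real.pi * (a - b) : ℝ)) - 1) := by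
    rw [mul_sub, mul_one, Real.fourierChar_apply, Real.fourierChar_apply, ← Complex.exp_add]
    congr 2
    push_cast
    ring
  rw [h, norm_mul, Circle.norm_coe, one_mul]
  refine Real.norm_exp_I_mul_ofReal_sub_one_le.trans_eq ?_
  rw [norm_mul, Real.norm_of_nonneg (by positivity), Real.norm_eq_abs]

/-- For `‖ξ‖ < A` the character of frequency `ξ` is `2πA`-Lipschitz in `x`; integrate this against
the `L¹` bound. -/
theorem enorm_band_sub_le (A : ℝ) (x y : E) :
    ‖band (Metric.ball 0 A) u x - band (Metric.ball 0 A) u y‖ₑ ≤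
      ENNReal.ofReal (2 * Real.pi * A * ‖x - y‖) *
        (eLpNorm u 2 volume * volume (Metric.ball (0 : E) A) ^ (1 / 2 : ℝ)) := by
  set S := Metric.ball (0 : E) A
  have hS : MeasurableSet S := measurableSet_ball
  have hS' : volume S ≠ ∞ := measure_ball_lt_top.ne
  have hi : ∀ x : E, Integrable (fun ξ => Real.fourierChar (inner ℝ ξ x) •
      S.indicator (𝓕 u : Lp ℂ 2 (volume : Measure E)) ξ) volume := fun x =>
    integrable_fourierChar_smul (integrable_indicator_fourier u hS hS') x
  calc ‖band S u x - band S u y‖ₑ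
      ≤ ∫⁻ ξ, ENNReal.ofReal (2 * Real.pi * A * ‖x - y‖) *
          ‖S.indicator (𝓕 u : Lp ℂ 2 (volume : Measure E)) ξ‖ₑ := by
        simp only [band, Real.fourierInv_eq]
        rw [← integral_sub (hi x) (hi y)]
        refine (enorm_integral_le_lintegral_enorm _).trans (lintegral_mono fun ξ => ?_)
        by_cases hξ : ξ ∈ S
        · rw [Circle.smul_def, Circle.smul_def, ← sub_smul, enorm_smul]
          gcongr
          rw [← ofReal_norm]
          refine ENNReal.ofReal_le_ofReal ((norm_fourierChar_sub_le _ _).trans ?_)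
          rw [mul_assoc _ A]
          gcongr
          rw [← inner_sub_right]
          refine (abs_real_inner_le_norm _ _).trans ?_
          gcongr
          exact (mem_ball_zero_iff.1 hξ).le
        · simp [hξ]
    _ ≤ _ := by
        rw [lintegral_const_mul' _ _ ENNReal.ofReal_ne_top, ← eLpNorm_one_eq_lintegral_enorm]
        gcongr
        refine (eLpNorm_one_indicator_fourier_le u hS).trans ?_
        gcongr
        exact eLpNorm_indicator_fourier_le u S

theorem band_ball_linearIsometryEquiv (A : ℝ) (R : E ≃ₗᵢ[ℝ] E) (hu : ⇑u ∘ R =ᵐ[volume] u) (x : E) :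
    band (Metric.ball 0 A) u (R x) = band (Metric.ball 0 A) u x := by
  have h1 : Lp.compMeasurePreserving R R.measurePreserving u = u :=
    Lp.ext ((Lp.coeFn_compMeasurePreserving u R.measurePreserving).trans hu)
  have h2 := fourier_compMeasurePreserving R u
  rw [h1] at h2
  have h3 : (𝓕 u : Lp ℂ 2 (volume : Measure E)) =ᵐ[volume]
      (𝓕 u : Lp ℂ 2 (volume : Measure E)) ∘ R := by
    conv_lhs => rw [h2]
    exact Lp.coeFn_compMeasurePreserving _ R.measurePreserving
  rw [band, ← Real.fourierInv_comp_linearIsometry]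
  refine Real.fourierInv_congr_ae ?_ x
  filter_upwards [h3] with ξ hξ
  have hR : R ξ ∈ Metric.ball (0 : E) A ↔ ξ ∈ Metric.ball (0 : E) A := by simp
  rw [Function.comp_apply]
  by_cases h : ξ ∈ Metric.ball (0 : E) A
  · rw [Set.indicator_of_mem h, Set.indicator_of_mem (hR.2 h), hξ, Function.comp_apply]
  · rw [Set.indicator_of_notMem h, Set.indicator_of_notMem (mt hR.1 h)]

end Band

/-- Interpolation between `L^∞` and `L²`, from `|w|^p ≤ K^(p-2) |w|²`. -/
theorem eLpNorm_le_of_enorm_le {α : Type*} [MeasurableSpace α] {μ : Measure α} {w : α → ℂ}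
    {K : ℝ≥0∞} {p : ℝ} (hp : 2 < p) (hKt : K ≠ ∞) (hK : ∀ x, ‖w x‖ₑ ≤ K) :
    eLpNorm w (ENNReal.ofReal p) μ ≤ K ^ (1 - 2 / p) * eLpNorm w 2 μ ^ (2 / p) := by
  have hp0 : 0 < p := by linarith
  rw [eLpNorm_eq_lintegral_rpow_enorm_toReal (by simpa using hp0) ENNReal.ofReal_ne_top,
    eLpNorm_eq_lintegral_rpow_enorm_toReal two_ne_zero ENNReal.ofNat_ne_top,
    ENNReal.toReal_ofReal hp0.le, ENNReal.toReal_ofNat, ← ENNReal.rpow_mul]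
  have h1 : ∫⁻ x, ‖w x‖ₑ ^ p ∂μ ≤ K ^ (p - 2) * ∫⁻ x, ‖w x‖ₑ ^ (2 : ℝ) ∂μ := by
    rw [← lintegral_const_mul' _ _ (by finiteness)]
    refine lintegral_mono fun x => ?_
    calc ‖w x‖ₑ ^ p = ‖w x‖ₑ ^ (p - 2) * ‖w x‖ₑ ^ (2 : ℝ) := by
          rw [← ENNReal.rpow_add_of_nonneg _ _ (by linarith) (by norm_num)]; ring_nf
      _ ≤ _ := by gcongr; exact hK x
  calc _ ≤ (K ^ (p - 2) * ∫⁻ x, ‖w x‖ₑ ^ (2 : ℝ) ∂μ) ^ (1 / p) := by gcongr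
    _ = _ := by
      rw [ENNReal.mul_rpow_of_nonneg _ _ (by positivity), ← ENNReal.rpow_mul]
      congr 2 <;> field_simp

/-! ### High frequencies and the Sobolev inequality -/

section Sobolev

variable {d : ℕ} {u : Lp ℂ 2 (volume : Measure (EuclideanSpace ℝ (Fin d)))}

theorem eLpNorm_le_h2Norm (u : Lp ℂ 2 (volume : Measure (EuclideanSpace ℝ (Fin d)))) :
    eLpNorm u 2 volume ≤ h2Norm u := by
  rw [h2Norm, one_div, ENNReal.le_rpow_inv_iff two_pos, ENNReal.rpow_two, add_assoc]
  exact le_self_add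

theorem distL2Norm_le_h2Norm (u : Lp ℂ 2 (volume : Measure (EuclideanSpace ℝ (Fin d))))
    (i : Fin d) :
    distL2Norm (∂_{EuclideanSpace.single i (1 : ℝ)} (∂_{EuclideanSpace.single i (1 : ℝ)}
      (u : 𝓢'(EuclideanSpace ℝ (Fin d), ℂ)))) ≤ h2Norm u := by
  rw [h2Norm, one_div, ENNReal.le_rpow_inv_iff two_pos, ENNReal.rpow_two]
  refine le_add_left ?_
  refine le_trans ?_ (Finset.single_le_sum (fun _ _ => zero_le) (Finset.mem_univ i))
  exact Finset.single_le_sum (f := fun j => distL2Norm (∂_{EuclideanSpace.single i (1 : ℝ)}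
    (∂_{EuclideanSpace.single j (1 : ℝ)} (u : 𝓢'(EuclideanSpace ℝ (Fin d), ℂ)))) ^ 2)
    (fun _ _ => zero_le) (Finset.mem_univ i)

theorem eLpNorm_sq_smul_fourier_le (u : Lp ℂ 2 (volume : Measure (EuclideanSpace ℝ (Fin d))))
    (i : Fin d) :
    eLpNorm (fun ξ : EuclideanSpace ℝ (Fin d) => ξ i ^ 2 •
      (𝓕 u : Lp ℂ 2 (volume : Measure (EuclideanSpace ℝ (Fin d)))) ξ) 2 volume ≤ h2Norm u := by
  -- It suffices to bound by each representative `f`; if there is none, the infimum is `∞`.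
  refine le_trans (le_iInf₂ fun f hf => ?_) (distL2Norm_le_h2Norm u i)
  rw [← eLpNorm_fourier_eq f]
  refine eLpNorm_mono_ae ?_
  filter_upwards [fourier_ae_eq_of_lineDerivOp_lineDerivOp_eq hf] with ξ hξ
  rw [hξ, norm_smul, norm_smul, Real.norm_eq_abs, Real.norm_eq_abs, abs_neg, abs_sq, abs_sq]
  gcongr ?_ * _
  rw [EuclideanSpace.inner_single_right]
  simp only [conj_trivial, one_mul, mul_pow]
  nlinarith [Real.pi_gt_three, sq_nonneg (ξ i),
    mul_nonneg (sq_nonneg (ξ i)) (by nlinarith [Real.pi_gt_three] : 0 ≤ 2 ^ 2 * Real.pi ^ 2 - 1)]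

/-- The `H²` norm controls the high frequencies of `u`. -/
theorem eLpNorm_indicator_fourier_le_h2Norm
    (u : Lp ℂ 2 (volume : Measure (EuclideanSpace ℝ (Fin d)))) {A : ℝ} (hA : 0 < A)
    {S : Set (EuclideanSpace ℝ (Fin d))} (hS : ∀ ξ ∈ S, A ≤ ‖ξ‖) :
    eLpNorm (S.indicator (𝓕 u : Lp ℂ 2 (volume : Measure (EuclideanSpace ℝ (Fin d))))) 2 volume ≤
      ENNReal.ofReal ((A ^ 2)⁻¹) * (d * h2Norm u) := by
  -- On `S`, `A² ≤ ‖ξ‖² = ∑ ξ i ^ 2`, so pure second derivatives suffice; the triangle inequality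
  -- over `i` then costs the factor `d`.
  have h1 : eLpNorm (S.indicator
      (𝓕 u : Lp ℂ 2 (volume : Measure (EuclideanSpace ℝ (Fin d))))) 2 volume ≤
      ENNReal.ofReal ((A ^ 2)⁻¹) * eLpNorm (∑ i : Fin d, fun ξ : EuclideanSpace ℝ (Fin d) =>
        ξ i ^ 2 • (𝓕 u : Lp ℂ 2 (volume : Measure (EuclideanSpace ℝ (Fin d)))) ξ) 2 volume := by
    refine eLpNorm_le_mul_eLpNorm_of_ae_le_mul (.of_forall fun ξ => ?_) 2
    by_cases hξ : ξ ∈ S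
    · rw [Set.indicator_of_mem hξ, Finset.sum_apply, ← Finset.sum_smul,
        ← EuclideanSpace.real_norm_sq_eq, norm_smul, ← mul_assoc]
      refine le_mul_of_one_le_left (norm_nonneg _) ?_
      rw [Real.norm_eq_abs, abs_sq, inv_mul_eq_div, one_le_div (by positivity)]
      gcongr
      exact hS ξ hξ
    · rw [Set.indicator_of_notMem hξ, norm_zero]
      positivity
  refine h1.trans ?_
  gcongr
  refine (eLpNorm_sum_le (fun i _ => ?_) one_le_two).trans ?_
  · exact AEStronglyMeasurable.smul
      (Continuous.aestronglyMeasurable (f := fun ξ : EuclideanSpace ℝ (Fin d) => ξ i ^ 2)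
        (by fun_prop)) (Lp.aestronglyMeasurable _)
  · refine (Finset.sum_le_sum fun i _ => eLpNorm_sq_smul_fourier_le u i).trans_eq ?_
    simp

/-- The shell's `L²` mass is at most `4⁻¹ ^ k * (d * h2Norm u)`, and its volume is `O(2 ^ (d * k))`;
interpolate between the sup and `L²` bounds. -/
theorem eLpNorm_band_shell_le (hu : h2Norm u ≠ ∞) (hd : 0 < d) {p : ℝ} (hp : 2 < p) (k : ℕ) :
    eLpNorm (band (Metric.ball 0 (2 ^ (k + 1)) \ Metric.ball 0 (2 ^ k)) u)
        (ENNReal.ofReal p) volume ≤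
      d * h2Norm u * (2 ^ d * volume (Metric.ball (0 : EuclideanSpace ℝ (Fin d)) 1)) ^
          ((1 - 2 / p) / 2) *
        (4⁻¹ * (2 ^ d) ^ ((1 - 2 / p) / 2)) ^ k := by
  have : Nonempty (Fin d) := ⟨⟨0, hd⟩⟩
  set S := Metric.ball (0 : EuclideanSpace ℝ (Fin d)) (2 ^ (k + 1)) \ Metric.ball 0 (2 ^ k)
  set V := volume (Metric.ball (0 : EuclideanSpace ℝ (Fin d)) 1)
  have hV : V ≠ ∞ := measure_ball_lt_top.ne
  set a : ℝ := (1 - 2 / p) / 2 with ha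
  have hp2 : 2 / p < 1 := (div_lt_one (by linarith)).2 hp
  have ha0 : 0 ≤ a := by rw [ha]; linarith
  have hS : MeasurableSet S := measurableSet_ball.diff measurableSet_ball
  have hSV : volume S ≤ (2 ^ d) ^ (k + 1) * V := by
    refine (measure_mono Set.sdiff_subset).trans_eq ?_
    rw [Measure.addHaar_ball _ _ (by positivity), finrank_euclideanSpace_fin,
      ENNReal.ofReal_pow (by positivity), ENNReal.ofReal_pow (by positivity), ENNReal.ofReal_ofNat,
      ← pow_mul, ← pow_mul, mul_comm (k + 1)]
  have hS' : volume S ≠ ∞ := (hSV.trans_lt (by finiteness)).ne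
  have hB : eLpNorm (S.indicator
      (𝓕 u : Lp ℂ 2 (volume : Measure (EuclideanSpace ℝ (Fin d))))) 2 volume ≤
      4⁻¹ ^ k * (d * h2Norm u) := by
    refine (eLpNorm_indicator_fourier_le_h2Norm u (A := 2 ^ k) (by positivity)
      fun ξ hξ => by simpa using hξ.2).trans_eq ?_
    congr 1
    rw [← pow_mul, mul_comm, pow_mul, ← inv_pow, ENNReal.ofReal_pow (by positivity),
      ENNReal.ofReal_inv_of_pos (by positivity)]
    norm_num
  set B := 4⁻¹ ^ k * (d * h2Norm u) with hBdef
  have hBt : B ≠ ∞ := by finiteness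
  refine (eLpNorm_le_of_enorm_le (K := B * ((2 ^ d) ^ (k + 1) * V) ^ (1 / 2 : ℝ)) hp
    (by finiteness) fun x => (enorm_band_le u hS x).trans (by gcongr)).trans ?_
  rw [eLpNorm_band u hS hS']
  calc _ ≤ (B * ((2 ^ d) ^ (k + 1) * V) ^ (1 / 2 : ℝ)) ^ (1 - 2 / p) * B ^ (2 / p) := by gcongr
    _ = B * ((2 ^ d) ^ (k + 1) * V) ^ a := by
      rw [ENNReal.mul_rpow_of_nonneg _ _ (by linarith), ← ENNReal.rpow_mul, mul_right_comm,
        ← ENNReal.rpow_add_of_nonneg _ _ (by linarith) (by positivity), sub_add_cancel,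
        ENNReal.rpow_one]
      congr 2
      rw [ha]; ring
    _ = _ := by
      rw [pow_succ, mul_assoc ((2 ^ d) ^ k), ENNReal.mul_rpow_of_nonneg _ _ ha0,
        ← ENNReal.rpow_natCast ((2 ^ d) : ℝ≥0∞) k, ← ENNReal.rpow_mul, mul_comm (k : ℝ) a,
        ENNReal.rpow_mul, ENNReal.rpow_natCast, hBdef, mul_pow]
      ring

theorem dyadic_ratio_lt_one {σ : ℝ} (hσ : H2Subcritical d σ) :
    (4⁻¹ * (2 ^ d) ^ ((1 - 2 / (2 * (σ + 1))) / 2) : ℝ≥0∞) < 1 := by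
  obtain ⟨h0, h1⟩ := hσ
  -- Equivalent to `d * σ < 4 * (σ + 1)`, which is automatic for `d ≤ 4` and is the subcritical
  -- bound otherwise.
  have key : (d : ℝ) * ((1 - 2 / (2 * (σ + 1))) / 2) < 2 := by
    have h2 : 1 - 2 / (2 * (σ + 1)) = σ / (σ + 1) := by field_simp; ring
    rw [h2, div_div, mul_div_assoc', div_lt_iff₀ (by positivity)]
    rcases le_or_gt d 4 with h | h
    · have : (d : ℝ) ≤ 4 := by exact_mod_cast h
      nlinarith
    · have h4 : (4 : ℝ) < d := by exact_mod_cast h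
      have := (lt_div_iff₀ (by linarith)).1 (h1 h)
      nlinarith
  rw [← ENNReal.rpow_natCast, ← ENNReal.rpow_mul]
  have h3 : (2 : ℝ≥0∞) ^ ((d : ℝ) * ((1 - 2 / (2 * (σ + 1))) / 2)) < 2 ^ (2 : ℝ) :=
    ENNReal.rpow_lt_rpow_of_exponent_lt (by norm_num) (by norm_num) key
  have h4 : (2 : ℝ≥0∞) ^ (2 : ℝ) = 4 := by rw [ENNReal.rpow_two]; norm_num
  rw [h4] at h3
  calc _ < (4⁻¹ * 4 : ℝ≥0∞) := by
        rw [ENNReal.mul_lt_mul_iff_right (by simp) (by simp)]; exact h3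
    _ = 1 := ENNReal.inv_mul_cancel (by simp) (by simp)

theorem aestronglyMeasurable_band_ball
    (u : Lp ℂ 2 (volume : Measure (EuclideanSpace ℝ (Fin d)))) (A : ℝ) :
    AEStronglyMeasurable (band (Metric.ball 0 A) u) volume :=
  (continuous_band u measurableSet_ball measure_ball_lt_top.ne).aestronglyMeasurable

theorem tendsto_eLpNorm_band_ball_sub (hu : h2Norm u ≠ ∞) :
    Tendsto (fun k : ℕ => eLpNorm (band (Metric.ball 0 (2 ^ k)) u - ⇑u) 2 volume) atTop (𝓝 0) := by
  have h : Tendsto (fun k : ℕ => ENNReal.ofReal (((2 ^ k : ℝ) ^ 2)⁻¹) * (d * h2Norm u))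
      atTop (𝓝 0) := by
    have h1 : Tendsto (fun k : ℕ => ((2 ^ k : ℝ) ^ 2)⁻¹) atTop (𝓝 0) := by
      refine tendsto_inv_atTop_zero.comp ((tendsto_pow_atTop two_ne_zero).comp ?_)
      exact tendsto_pow_atTop_atTop_of_one_lt one_lt_two
    have h2 := ENNReal.Tendsto.mul_const (b := d * h2Norm u) (ENNReal.tendsto_ofReal h1)
      (.inr (by finiteness))
    simpa using h2
  refine tendsto_of_tendsto_of_tendsto_of_le_of_le tendsto_const_nhds h (fun _ => zero_le)
    fun k => ?_
  rw [eLpNorm_sub_comm, eLpNorm_sub_band u measurableSet_ball measure_ball_lt_top.ne]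
  exact eLpNorm_indicator_fourier_le_h2Norm u (by positivity) fun ξ hξ => by simpa using hξ

/-- Littlewood-Paley form of the Sobolev embedding: the frequencies above `2 ^ k` have a small
`L^(2(σ+1))` norm. -/
theorem exists_eLpNorm_sub_band_ball_le (hd : 0 < d) {σ : ℝ} (hσ : H2Subcritical d σ) :
    ∃ D q : ℝ≥0∞, D ≠ ∞ ∧ q < 1 ∧
      ∀ u : Lp ℂ 2 (volume : Measure (EuclideanSpace ℝ (Fin d))), h2Norm u ≠ ∞ → ∀ k : ℕ,
        eLpNorm (⇑u - band (Metric.ball 0 (2 ^ k)) u) (ENNReal.ofReal (2 * (σ + 1))) volume ≤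
          D * q ^ k * h2Norm u := by
  have hp : 2 < 2 * (σ + 1) := by linarith [hσ.1]
  set p := 2 * (σ + 1)
  set V := volume (Metric.ball (0 : EuclideanSpace ℝ (Fin d)) 1)
  have hV : V ≠ ∞ := measure_ball_lt_top.ne
  set q : ℝ≥0∞ := 4⁻¹ * (2 ^ d) ^ ((1 - 2 / p) / 2) with hq
  have hq1 : q < 1 := dyadic_ratio_lt_one hσ
  have hp2 : 2 / p < 1 := (div_lt_one (by linarith)).2 hp
  have ha0 : 0 ≤ (1 - 2 / p) / 2 := by linarith
  set C : ℝ≥0∞ := d * (2 ^ d * V) ^ ((1 - 2 / p) / 2)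
  have hC : C ≠ ∞ := by finiteness
  have h1p : 1 ≤ ENNReal.ofReal p := by
    rw [← ENNReal.ofReal_one]; exact ENNReal.ofReal_le_ofReal (by linarith)
  refine ⟨C * (1 - q)⁻¹, q, ENNReal.mul_ne_top hC
    (ENNReal.inv_ne_top.2 (tsub_pos_of_lt hq1).ne'), hq1, fun u hu k => ?_⟩
  have hstep : ∀ j : ℕ, eLpNorm (band (Metric.ball 0 (2 ^ (j + 1))) u -
      band (Metric.ball 0 (2 ^ j)) u) (ENNReal.ofReal p) volume ≤ C * h2Norm u * q ^ j := by
    intro j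
    have : band (Metric.ball 0 (2 ^ (j + 1))) u - band (Metric.ball 0 (2 ^ j)) u =
        band (Metric.ball 0 (2 ^ (j + 1)) \ Metric.ball 0 (2 ^ j)) u := by
      ext x
      exact band_sub_band u measurableSet_ball measurableSet_ball measure_ball_lt_top.ne
        (Metric.ball_subset_ball (pow_le_pow_right₀ one_le_two (Nat.le_succ j))) x
    rw [this]
    refine (eLpNorm_band_shell_le hu hd hp j).trans_eq ?_
    ring
  have hsum : ∀ m : ℕ, eLpNorm (band (Metric.ball 0 (2 ^ (k + m))) u -
      band (Metric.ball 0 (2 ^ k)) u) (ENNReal.ofReal p) volume ≤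
        C * h2Norm u * q ^ k * ∑ i ∈ Finset.range m, q ^ i := by
    intro m
    induction m with
    | zero => simp
    | succ m ih =>
      rw [← sub_add_sub_cancel _ (band (Metric.ball 0 (2 ^ (k + m))) u), Finset.sum_range_succ,
        mul_add, add_comm]
      refine (eLpNorm_add_le ((aestronglyMeasurable_band_ball u _).sub (aestronglyMeasurable_band_ball u _))
        ((aestronglyMeasurable_band_ball u _).sub (aestronglyMeasurable_band_ball u _)) h1p).trans ?_
      refine (add_le_add ih (hstep (k + m))).trans_eq ?_
      rw [pow_add]
      ring
  have hbound : ∀ j ≥ k, eLpNorm (band (Metric.ball 0 (2 ^ j)) u -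
      band (Metric.ball 0 (2 ^ k)) u) (ENNReal.ofReal p) volume ≤
        C * (1 - q)⁻¹ * q ^ k * h2Norm u := by
    intro j hj
    obtain ⟨m, rfl⟩ := Nat.exists_eq_add_of_le hj
    refine (hsum m).trans ?_
    calc _ ≤ C * h2Norm u * q ^ k * (1 - q)⁻¹ := by
          gcongr
          rw [← ENNReal.tsum_geometric]
          exact ENNReal.sum_le_tsum _
      _ = _ := by ring
  -- The telescoping bound only concerns truncations of `u`. They converge to `u` in `L²`, hence
  -- a.e. along a subsequence, and Fatou carries the bound to `u`.
  obtain ⟨ns, hns, hae⟩ := (tendstoInMeasure_of_tendsto_eLpNorm two_ne_zero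
    (fun j => aestronglyMeasurable_band_ball u _) (Lp.aestronglyMeasurable u)
    (tendsto_eLpNorm_band_ball_sub hu)).exists_seq_tendsto_ae
  refine (Lp.eLpNorm_lim_le_liminf_eLpNorm (f := fun j => band (Metric.ball 0 (2 ^ ns j)) u -
      band (Metric.ball 0 (2 ^ k)) u)
    (fun j => (aestronglyMeasurable_band_ball u _).sub (aestronglyMeasurable_band_ball u _)) _ ?_).trans ?_
  · filter_upwards [hae] with x hx
    exact hx.sub_const _
  · refine liminf_le_of_frequently_le' (Eventually.frequently ?_)
    filter_upwards [hns.tendsto_atTop.eventually_ge_atTop k] with j hj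
    exact hbound _ hj

theorem eLpNorm_band_ball_one_le (u : Lp ℂ 2 (volume : Measure (EuclideanSpace ℝ (Fin d))))
    (hu : h2Norm u ≠ ∞) {p : ℝ} (hp : 2 < p) :
    eLpNorm (band (Metric.ball 0 1) u) (ENNReal.ofReal p) volume ≤
      (volume (Metric.ball (0 : EuclideanSpace ℝ (Fin d)) 1) ^ (1 / 2 : ℝ)) ^ (1 - 2 / p) *
        h2Norm u := by
  have hV : volume (Metric.ball (0 : EuclideanSpace ℝ (Fin d)) 1) ≠ ∞ := measure_ball_lt_top.ne
  have hp2 : 2 / p < 1 := (div_lt_one (by linarith)).2 hp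
  have h2 := (eLpNorm_indicator_fourier_le u (Metric.ball 0 1)).trans (eLpNorm_le_h2Norm u)
  refine (eLpNorm_le_of_enorm_le hp
    (K := h2Norm u * volume (Metric.ball (0 : EuclideanSpace ℝ (Fin d)) 1) ^ (1 / 2 : ℝ))
    (by finiteness) fun x => (enorm_band_le u measurableSet_ball x).trans (by gcongr)).trans ?_
  rw [eLpNorm_band u measurableSet_ball hV]
  calc _ ≤ (h2Norm u * volume (Metric.ball (0 : EuclideanSpace ℝ (Fin d)) 1) ^ (1 / 2 : ℝ)) ^
          (1 - 2 / p) * h2Norm u ^ (2 / p) := by gcongr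
    _ = _ := by
      rw [ENNReal.mul_rpow_of_nonneg _ _ (by linarith), mul_right_comm,
        ← ENNReal.rpow_add_of_nonneg _ _ (by linarith) (by positivity), sub_add_cancel,
        ENNReal.rpow_one, mul_comm]

theorem exists_eLpNorm_le_h2Norm (hd : 0 < d) {σ : ℝ} (hσ : H2Subcritical d σ) :
    ∃ C : ℝ≥0, ∀ u : Lp ℂ 2 (volume : Measure (EuclideanSpace ℝ (Fin d))), h2Norm u ≠ ∞ →
      eLpNorm u (ENNReal.ofReal (2 * (σ + 1))) volume ≤ C * h2Norm u := by
  have hp : 2 < 2 * (σ + 1) := by linarith [hσ.1]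
  have hp2 : 2 / (2 * (σ + 1)) < 1 := (div_lt_one (by linarith)).2 hp
  have h1p : 1 ≤ ENNReal.ofReal (2 * (σ + 1)) := by
    rw [← ENNReal.ofReal_one]; exact ENNReal.ofReal_le_ofReal (by linarith)
  have hV : volume (Metric.ball (0 : EuclideanSpace ℝ (Fin d)) 1) ≠ ∞ := measure_ball_lt_top.ne
  obtain ⟨D, q, hD, -, h⟩ := exists_eLpNorm_sub_band_ball_le hd hσ
  set V := (volume (Metric.ball (0 : EuclideanSpace ℝ (Fin d)) 1) ^ (1 / 2 : ℝ)) ^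
    (1 - 2 / (2 * (σ + 1)))
  have hV' : V ≠ ∞ :=
    ENNReal.rpow_ne_top_of_nonneg (by linarith) (ENNReal.rpow_ne_top_of_nonneg (by positivity) hV)
  refine ⟨(D + V).toNNReal, fun u hu => ?_⟩
  rw [ENNReal.coe_toNNReal (ENNReal.add_ne_top.2 ⟨hD, hV'⟩), add_mul]
  -- At `k = 0` the tail is everything outside the unit ball of frequencies.
  have h0 := h u hu 0
  simp only [pow_zero, mul_one] at h0
  calc _ = eLpNorm ((⇑u - band (Metric.ball 0 1) u) + band (Metric.ball 0 1) u)
        (ENNReal.ofReal (2 * (σ + 1))) volume := by rw [sub_add_cancel]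
    _ ≤ _ := eLpNorm_add_le ((Lp.aestronglyMeasurable u).sub (aestronglyMeasurable_band_ball u _))
        (aestronglyMeasurable_band_ball u _) h1p
    _ ≤ _ := add_le_add h0 (eLpNorm_band_ball_one_le u hu hp)

end Sobolev

/-! ### Decay of radial functions -/

section Radial

variable {d : ℕ}

theorem IsRadial.comp_linearIsometryEquiv {u : EuclideanSpace ℝ (Fin d) → ℂ} (hu : IsRadial u)
    (R : EuclideanSpace ℝ (Fin d) ≃ₗᵢ[ℝ] EuclideanSpace ℝ (Fin d)) : u ∘ R =ᵐ[volume] u := by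
  obtain ⟨g, hg⟩ := hu
  refine (R.measurePreserving.quasiMeasurePreserving.ae_eq_comp hg).trans ?_
  filter_upwards [hg] with x hx
  simp [hx]

theorem band_ball_eq_of_norm_eq {u : Lp ℂ 2 (volume : Measure (EuclideanSpace ℝ (Fin d)))}
    (hu : IsRadial u) (A : ℝ) {x y : EuclideanSpace ℝ (Fin d)} (h : ‖x‖ = ‖y‖) :
    band (Metric.ball 0 A) u x = band (Metric.ball 0 A) u y := by
  -- The reflection in the hyperplane orthogonal to `x - y` carries `x` to `y`.
  rw [← Submodule.reflection_sub h]
  exact (band_ball_linearIsometryEquiv u A _ (hu.comp_linearIsometryEquiv _) x).symm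

theorem norm_band_ball_sub_le {u : Lp ℂ 2 (volume : Measure (EuclideanSpace ℝ (Fin d)))}
    {M : ℝ≥0∞} (hM : M ≠ ∞) (hu : eLpNorm u 2 volume ≤ M) {A : ℝ} (hA : 0 ≤ A)
    (x y : EuclideanSpace ℝ (Fin d)) :
    ‖band (Metric.ball 0 A) u x - band (Metric.ball 0 A) u y‖ ≤
      2 * Real.pi * A *
        (M * volume (Metric.ball (0 : EuclideanSpace ℝ (Fin d)) A) ^ (1 / 2 : ℝ)).toReal *
        ‖x - y‖ := by
  have hV : volume (Metric.ball (0 : EuclideanSpace ℝ (Fin d)) A) ≠ ∞ := measure_ball_lt_top.ne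
  have h := (enorm_band_sub_le u A x y).trans
    (mul_le_mul_right (mul_le_mul_left hu _) _)
  have h' := ENNReal.toReal_mono (by finiteness) h
  rw [toReal_enorm, ENNReal.toReal_mul, ENNReal.toReal_ofReal (by positivity)] at h'
  linarith

/-- `(r + δ)^d - r^d ≥ r^(d-1) δ ≥ r δ`; the last step needs `d ≥ 2` and `r ≥ 1`. -/
theorem volume_shell_ge (hd : 2 ≤ d) {r δ : ℝ} (hr : 1 ≤ r) (hδ : 0 ≤ δ) :
    ENNReal.ofReal (r * δ) * volume (Metric.ball (0 : EuclideanSpace ℝ (Fin d)) 1) ≤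
      volume (Metric.ball (0 : EuclideanSpace ℝ (Fin d)) (r + δ) \ Metric.ball 0 r) := by
  have : Nonempty (Fin d) := ⟨⟨0, by omega⟩⟩
  rw [measure_sdiff (Metric.ball_subset_ball (by linarith)) measurableSet_ball.nullMeasurableSet
    measure_ball_lt_top.ne, Measure.addHaar_ball _ _ (by linarith : 0 ≤ r + δ),
    Measure.addHaar_ball _ _ (by linarith : 0 ≤ r), finrank_euclideanSpace_fin,
    ← ENNReal.sub_mul (fun _ _ => measure_ball_lt_top.ne), ← ENNReal.ofReal_sub _ (by positivity)]
  gcongr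
  obtain ⟨m, rfl⟩ := Nat.exists_eq_add_of_le' hd
  have h1 : r ^ (m + 1) ≤ (r + δ) ^ (m + 1) := by gcongr; linarith
  have h2 : r ≤ r ^ (m + 1) := le_self_pow₀ hr (by omega)
  rw [pow_succ (r + δ) (m + 1), pow_succ r (m + 1)]
  nlinarith

/-- Radial functions that are bounded in `L²` and equi-Lipschitz decay uniformly at infinity. -/
theorem exists_radius_norm_le (hd : 2 ≤ d) {M : ℝ≥0∞} (hM : M ≠ ∞) {L ε : ℝ} (hL : 0 ≤ L)
    (hε : 0 < ε) :
    ∃ R : ℝ, ∀ w : EuclideanSpace ℝ (Fin d) → ℂ, (∀ x y, ‖x‖ = ‖y‖ → w x = w y) →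
      (∀ x y, ‖w x - w y‖ ≤ L * ‖x - y‖) → AEStronglyMeasurable w volume →
      eLpNorm w 2 volume ≤ M → ∀ x, R ≤ ‖x‖ → ‖w x‖ ≤ ε := by
  have : Nonempty (Fin d) := ⟨⟨0, by omega⟩⟩
  set V := volume (Metric.ball (0 : EuclideanSpace ℝ (Fin d)) 1)
  have hV : V ≠ ∞ := measure_ball_lt_top.ne
  have hV0 : V ≠ 0 := (Metric.measure_ball_pos _ _ one_pos).ne'
  have hVr : 0 < V.toReal := ENNReal.toReal_pos hV0 hV
  set δ := ε / (2 * (L + 1)) with hδdef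
  have hδ : 0 < δ := by positivity
  have hLδ : L * δ ≤ ε / 2 := by
    rw [hδdef, mul_div_assoc', div_le_div_iff₀ (by positivity) two_pos]
    nlinarith
  -- Beyond this radius, Chebyshev at level `ε / 2` on a shell of thickness `δ` contradicts the
  -- bound `M`.
  refine ⟨max 1 (M.toReal ^ 2 / ((ε / 2) ^ 2 * δ * V.toReal) + 1),
    fun w hrad hlip hmeas hwM x hx => ?_⟩
  by_contra! hlt
  have hx1 : 1 ≤ ‖x‖ := (le_max_left _ _).trans hx
  have hx2 : M.toReal ^ 2 / ((ε / 2) ^ 2 * δ * V.toReal) < ‖x‖ := by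
    linarith [(le_max_right _ _).trans hx]
  have hsub : Metric.ball 0 (‖x‖ + δ) \ Metric.ball 0 ‖x‖ ⊆
      {y | ENNReal.ofReal (ε / 2) ≤ ‖w y‖ₑ} := by
    rintro y ⟨hy1, hy2⟩
    simp only [Metric.mem_ball, dist_zero_right, not_lt] at hy1 hy2
    have hy0 : 0 < ‖y‖ := by linarith
    -- The radial projection of `y` to the sphere through `x`: `w z = w x`, and `z` is `δ`-close to
    -- `y`.
    set z := (‖x‖ / ‖y‖) • y
    have hz : ‖z‖ = ‖x‖ := by
      rw [norm_smul, norm_div, norm_norm, norm_norm, div_mul_cancel₀ _ hy0.ne']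
    have hyz : ‖z - y‖ ≤ δ := by
      have : z - y = (‖x‖ / ‖y‖ - 1) • y := by rw [sub_smul, one_smul]
      rw [this, norm_smul, Real.norm_eq_abs, abs_of_nonpos
        (by rw [sub_nonpos, div_le_one hy0]; exact hy2)]
      have : -(‖x‖ / ‖y‖ - 1) * ‖y‖ = ‖y‖ - ‖x‖ := by field_simp; ring
      rw [this]
      linarith
    have h1 := hlip z y
    rw [hrad z x hz] at h1
    have h2 : L * ‖z - y‖ ≤ L * δ := by gcongr
    have h3 := norm_sub_norm_le (w x) (w y)
    rw [Set.mem_ofPred_eq, ← ofReal_norm]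
    exact ENNReal.ofReal_le_ofReal (by linarith)
  have hcheb := mul_meas_ge_le_pow_eLpNorm' volume two_ne_zero ENNReal.ofNat_ne_top hmeas
    (ENNReal.ofReal (ε / 2))
  rw [ENNReal.toReal_ofNat, ENNReal.rpow_two, ENNReal.rpow_two] at hcheb
  have hfin : ENNReal.ofReal (ε / 2) ^ 2 * (ENNReal.ofReal (‖x‖ * δ) * V) ≤ M ^ 2 := by
    calc _ ≤ ENNReal.ofReal (ε / 2) ^ 2 * volume {y | ENNReal.ofReal (ε / 2) ≤ ‖w y‖ₑ} := by
          gcongr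
          exact (volume_shell_ge hd hx1 hδ.le).trans (measure_mono hsub)
      _ ≤ _ := hcheb.trans (by gcongr)
  have hr := ENNReal.toReal_mono (by finiteness) hfin
  rw [ENNReal.toReal_mul, ENNReal.toReal_mul, ENNReal.toReal_pow, ENNReal.toReal_pow,
    ENNReal.toReal_ofReal (by positivity), ENNReal.toReal_ofReal (by positivity)] at hr
  rw [div_lt_iff₀ (by positivity)] at hx2
  linarith

end Radial

/-! ### Weak limits and strong convergence -/

section Compactness

/-- Sequential Banach-Alaoglu, transported by the Riesz isomorphism. -/
theorem exists_subseq_tendsto_inner {H : Type*} [NormedAddCommGroup H] [InnerProductSpace ℂ H]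
    [CompleteSpace H] [TopologicalSpace.SeparableSpace H] {u : ℕ → H} {M : ℝ}
    (hu : ∀ n, ‖u n‖ ≤ M) :
    ∃ φ : ℕ → ℕ, StrictMono φ ∧ ∃ v : H, ∀ h : H,
      Tendsto (fun n => inner ℂ (u (φ n)) h) atTop (𝓝 (inner ℂ v h)) := by
  obtain ⟨a, -, φ, hφ, hlim⟩ := WeakDual.isSeqCompact_closedBall ℂ H 0 M
    (x := fun n => StrongDual.toWeakDual (InnerProductSpace.toDual ℂ H (u n)))
    (fun n => by simpa using hu n)
  refine ⟨φ, hφ, (InnerProductSpace.toDual ℂ H).symm (WeakDual.toStrongDual a), fun h => ?_⟩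
  rw [InnerProductSpace.toDual_symm_apply]
  exact ((WeakDual.eval_continuous h).tendsto a).comp hlim

theorem eventually_forall_norm_sub_le {E : Type*} [NormedAddCommGroup E] [ProperSpace E]
    {w : ℕ → E → ℂ} {L ε : ℝ} (hL : 0 ≤ L) (hε : 0 < ε)
    (hlip : ∀ n x y, ‖w n x - w n y‖ ≤ L * ‖x - y‖)
    (hdecay : ∃ R : ℝ, ∀ n x, R ≤ ‖x‖ → ‖w n x‖ ≤ ε / 2)
    (hlim : ∀ x, CauchySeq fun n => w n x) :
    ∀ᶠ n : ℕ × ℕ in atTop, ∀ x, ‖w n.1 x - w n.2 x‖ ≤ ε := by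
  obtain ⟨R, hR⟩ := hdecay
  set δ := ε / (3 * (L + 1)) with hδdef
  have hδ : 0 < δ := by positivity
  have hLδ : L * δ ≤ ε / 3 := by
    rw [hδdef, mul_div_assoc', div_le_div_iff₀ (by positivity) three_pos]
    nlinarith
  -- Pointwise Cauchy control on a finite `δ`-net becomes uniform on the ball by the Lipschitz
  -- bound, with `ε / 3` for each of the three differences.
  obtain ⟨t, -, ht, hcov⟩ := (isCompact_closedBall (0 : E) R).finite_cover_balls hδ
  have hev : ∀ᶠ n : ℕ × ℕ in atTop, ∀ y ∈ t, dist (w n.1 y) (w n.2 y) < ε / 3 :=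
    (eventually_all_finite ht).2 fun y _ =>
      (cauchySeq_iff_tendsto_dist_atTop_0.1 (hlim y)).eventually_lt_const (by positivity)
  filter_upwards [hev] with n hn x
  rcases le_or_gt R ‖x‖ with h | h
  · exact (norm_sub_le _ _).trans (by linarith [hR n.1 x h, hR n.2 x h])
  · obtain ⟨y, hy, hxy⟩ := Set.mem_iUnion₂.1 (hcov (mem_closedBall_zero_iff.2 h.le))
    rw [Metric.mem_ball, dist_eq_norm] at hxy
    have h1 : L * ‖x - y‖ ≤ L * δ := by gcongr
    have h2 := hlip n.1 x y
    have h3 := hlip n.2 x y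
    have h4 := hn y hy
    rw [dist_eq_norm] at h4
    have h5 : w n.1 x - w n.2 x =
        (w n.1 x - w n.1 y) + (w n.1 y - w n.2 y) - (w n.2 x - w n.2 y) := by ring
    rw [h5]
    refine (norm_sub_le _ _).trans ?_
    linarith [norm_add_le (w n.1 x - w n.1 y) (w n.1 y - w n.2 y)]

variable {d : ℕ}

/-- A character cut off to a set of finite measure lies in `L²`. Hence weak convergence gives
pointwise convergence of `band`, along one subsequence for all radii and points. -/
theorem exists_band_eq_inner {S : Set (EuclideanSpace ℝ (Fin d))} (hS : MeasurableSet S)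
    (hS' : volume S ≠ ∞) (x : EuclideanSpace ℝ (Fin d)) :
    ∃ h : Lp ℂ 2 (volume : Measure (EuclideanSpace ℝ (Fin d))),
      ∀ u : Lp ℂ 2 (volume : Measure (EuclideanSpace ℝ (Fin d))),
        band S u x = inner ℂ h (𝓕 u) := by
  have hm : MemLp (S.indicator fun ξ => (Real.fourierChar (-inner ℝ ξ x) : ℂ)) 2 volume := by
    rw [memLp_indicator_iff_restrict hS]
    have : Fact (volume S < ∞) := ⟨hS'.lt_top⟩
    refine MemLp.of_bound ?_ 1 (.of_forall fun ξ => (Circle.norm_coe _).le)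
    exact Continuous.aestronglyMeasurable (by fun_prop)
  refine ⟨hm.toLp _, fun u => ?_⟩
  rw [L2.inner_def, band, Real.fourierInv_eq]
  refine integral_congr_ae ?_
  filter_upwards [hm.coeFn_toLp] with ξ hξ
  rw [hξ]
  by_cases h : ξ ∈ S
  · rw [Set.indicator_of_mem h, Set.indicator_of_mem h, RCLike.inner_apply', Circle.smul_def,
      smul_eq_mul, AddChar.map_neg_eq_inv, Circle.coe_inv_eq_conj]
    simp
  · simp [h]

theorem exists_subseq_cauchySeq_band
    {u : ℕ → Lp ℂ 2 (volume : Measure (EuclideanSpace ℝ (Fin d)))} {M : ℝ}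
    (hu : ∀ n, ‖u n‖ ≤ M) :
    ∃ φ : ℕ → ℕ, StrictMono φ ∧ ∀ (A : ℝ) (x : EuclideanSpace ℝ (Fin d)),
      CauchySeq fun n => band (Metric.ball 0 A) (u (φ n)) x := by
  have : Fact ((2 : ℝ≥0∞) ≠ ∞) := ⟨ENNReal.ofNat_ne_top⟩
  obtain ⟨φ, hφ, v, hv⟩ := exists_subseq_tendsto_inner
    (u := fun n => (𝓕 (u n) : Lp ℂ 2 (volume : Measure (EuclideanSpace ℝ (Fin d))))) (M := M)
    (fun n => (Lp.norm_fourier_eq (u n)).trans_le (hu n))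
  refine ⟨φ, hφ, fun A x => ?_⟩
  obtain ⟨h, hh⟩ := exists_band_eq_inner (measurableSet_ball (x := 0) (ε := A))
    measure_ball_lt_top.ne x
  simp only [hh]
  simp only [← inner_conj_symm h]
  exact ((Complex.continuous_conj.tendsto _).comp (hv h)).cauchySeq

/-- The low frequencies of a weakly convergent bounded sequence of radial functions converge
in `L^p`. -/
theorem tendsto_eLpNorm_band_sub_band (hd : 2 ≤ d)
    {u : ℕ → Lp ℂ 2 (volume : Measure (EuclideanSpace ℝ (Fin d)))} {M : ℝ≥0∞} (hM : M ≠ ∞)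
    (hrad : ∀ n, IsRadial (u n)) (hu : ∀ n, eLpNorm (u n) 2 volume ≤ M) {A : ℝ} (hA : 0 ≤ A)
    (hlim : ∀ x, CauchySeq fun n => band (Metric.ball 0 A) (u n) x) {p : ℝ} (hp : 2 < p) :
    Tendsto (fun n : ℕ × ℕ => eLpNorm (band (Metric.ball 0 A) (u n.1) -
      band (Metric.ball 0 A) (u n.2)) (ENNReal.ofReal p) volume) atTop (𝓝 0) := by
  have hp2 : 2 / p < 1 := (div_lt_one (by linarith)).2 hp
  have hband : ∀ n, eLpNorm (band (Metric.ball 0 A) (u n)) 2 volume ≤ M := fun n => by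
    rw [eLpNorm_band _ measurableSet_ball measure_ball_lt_top.ne]
    exact (eLpNorm_indicator_fourier_le _ _).trans (hu n)
  have hC : (M + M) ^ (2 / p) ≠ ∞ := by
    have : 0 ≤ 2 / p := by positivity
    finiteness
  -- The interpolation bound for a difference of sup norm at most `ε` and `L²` norm at most `2M`; it
  -- vanishes with `ε` because `p > 2`.
  have hsmall : Tendsto (fun ε : ℝ => ENNReal.ofReal ε ^ (1 - 2 / p) * (M + M) ^ (2 / p))
      (𝓝[>] 0) (𝓝 0) := by
    have h1 : Tendsto (fun ε : ℝ => ENNReal.ofReal ε ^ (1 - 2 / p)) (𝓝[>] 0) (𝓝 0) := by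
      have := ((ENNReal.continuous_rpow_const (y := 1 - 2 / p)).comp
        ENNReal.continuous_ofReal).tendsto 0
      simp only [Function.comp_apply, ENNReal.ofReal_zero,
        ENNReal.zero_rpow_of_pos (sub_pos.2 hp2)] at this
      exact this.mono_left nhdsWithin_le_nhds
    simpa using ENNReal.Tendsto.mul_const h1 (.inr hC)
  rw [ENNReal.tendsto_nhds_zero]
  intro η hη
  obtain ⟨ε, hεη, hε⟩ :=
    ((ENNReal.tendsto_nhds_zero.1 hsmall η hη).and self_mem_nhdsWithin).exists
  have hε : 0 < ε := hε
  have hL : 0 ≤ 2 * Real.pi * A *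
      (M * volume (Metric.ball (0 : EuclideanSpace ℝ (Fin d)) A) ^ (1 / 2 : ℝ)).toReal := by
    positivity
  obtain ⟨R, hR⟩ := exists_radius_norm_le hd hM hL (half_pos hε)
  have hlip := fun n => norm_band_ball_sub_le hM (hu n) hA
  filter_upwards [eventually_forall_norm_sub_le hL hε hlip ⟨R, fun n => hR _
    (fun x y => band_ball_eq_of_norm_eq (hrad n) A) (hlip n) (aestronglyMeasurable_band_ball _ _)
    (hband n)⟩ hlim] with n hn
  refine le_trans ?_ hεη
  refine (eLpNorm_le_of_enorm_le (K := ENNReal.ofReal ε) hp ENNReal.ofReal_ne_top fun x => ?_).trans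
    ?_
  · rw [← ofReal_norm]
    exact ENNReal.ofReal_le_ofReal (hn x)
  · gcongr
    exact (eLpNorm_sub_le (aestronglyMeasurable_band_ball _ _) (aestronglyMeasurable_band_ball _ _) one_le_two).trans
      (add_le_add (hband _) (hband _))

theorem tendsto_eLpNorm_sub_of_cauchySeq_band (hd : 2 ≤ d) {σ : ℝ} (hσ : H2Subcritical d σ)
    {u : ℕ → Lp ℂ 2 (volume : Measure (EuclideanSpace ℝ (Fin d)))} {M : ℝ≥0∞} (hM : M ≠ ∞)
    (hrad : ∀ n, IsRadial (u n)) (hu : ∀ n, h2Norm (u n) ≤ M)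
    (hlim : ∀ (A : ℝ) (x : EuclideanSpace ℝ (Fin d)),
      CauchySeq fun n => band (Metric.ball 0 A) (u n) x) :
    Tendsto (fun n : ℕ × ℕ => eLpNorm (⇑(u n.1) - ⇑(u n.2)) (ENNReal.ofReal (2 * (σ + 1))) volume)
      atTop (𝓝 0) := by
  have hp : 2 < 2 * (σ + 1) := by linarith [hσ.1]
  have h1p : 1 ≤ ENNReal.ofReal (2 * (σ + 1)) := by
    rw [← ENNReal.ofReal_one]; exact ENNReal.ofReal_le_ofReal (by linarith)
  obtain ⟨D, q, hD, hq, htail⟩ := exists_eLpNorm_sub_band_ball_le (by omega) hσ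
  have hgeom : Tendsto (fun k : ℕ => D * q ^ k * M) atTop (𝓝 0) := by
    have h1 := ENNReal.Tendsto.const_mul (a := D) (ENNReal.tendsto_pow_atTop_nhds_zero_of_lt_one hq)
      (.inr hD)
    simpa using ENNReal.Tendsto.mul_const h1 (.inr hM)
  rw [ENNReal.tendsto_nhds_zero]
  intro η hη
  have hη3 : 0 < η / 3 := ENNReal.div_pos hη.ne' (by simp)
  obtain ⟨k, hk⟩ := (ENNReal.tendsto_nhds_zero.1 hgeom _ hη3).exists
  have htail' : ∀ n, eLpNorm (⇑(u n) - band (Metric.ball 0 (2 ^ k)) (u n))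
      (ENNReal.ofReal (2 * (σ + 1))) volume ≤ η / 3 := fun n =>
    (htail _ ((hu n).trans_lt hM.lt_top).ne k).trans ((by gcongr; exact hu n : _ ≤ _).trans hk)
  filter_upwards [ENNReal.tendsto_nhds_zero.1 (tendsto_eLpNorm_band_sub_band hd hM hrad
    (fun n => (eLpNorm_le_h2Norm _).trans (hu n)) (A := 2 ^ k) (by positivity) (hlim _) hp)
    _ hη3] with n hn
  have hm := fun m => aestronglyMeasurable_band_ball (u m) (2 ^ k)
  have hm' := fun m => Lp.aestronglyMeasurable (u m)
  have hsplit : ⇑(u n.1) - ⇑(u n.2) = ((⇑(u n.1) - band (Metric.ball 0 (2 ^ k)) (u n.1)) +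
      (band (Metric.ball 0 (2 ^ k)) (u n.1) - band (Metric.ball 0 (2 ^ k)) (u n.2))) -
      (⇑(u n.2) - band (Metric.ball 0 (2 ^ k)) (u n.2)) := by abel
  rw [hsplit]
  calc _ ≤ _ := eLpNorm_sub_le (((hm' _).sub (hm _)).add ((hm _).sub (hm _)))
        ((hm' _).sub (hm _)) h1p
    _ ≤ (η / 3 + η / 3) + η / 3 := add_le_add ((eLpNorm_add_le ((hm' _).sub (hm _))
        ((hm _).sub (hm _)) h1p).trans (add_le_add (htail' _) hn)) (htail' _)
    _ = η := ENNReal.add_thirds η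

end Compactness

theorem mainTheorem6 (d : ℕ) (hd : 2 ≤ d) (σ : ℝ) (hσ : H2Subcritical d σ) :
    (∃ C : ℝ≥0, ∀ u ∈ H2Radial d,
      MemLp u (ENNReal.ofReal (2 * (σ + 1))) volume ∧
        eLpNorm u (ENNReal.ofReal (2 * (σ + 1))) volume ≤ C * h2Norm u) ∧
    ∀ u : ℕ → Lp ℂ 2 (volume : Measure (EuclideanSpace ℝ (Fin d))),
      (∀ n, u n ∈ H2Radial d) → (∃ M : ℝ≥0, ∀ n, h2Norm (u n) ≤ M) →
        ∃ φ : ℕ → ℕ, StrictMono φ ∧ ∃ v : EuclideanSpace ℝ (Fin d) → ℂ,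
          MemLp v (ENNReal.ofReal (2 * (σ + 1))) volume ∧
          Tendsto (fun n => eLpNorm (⇑(u (φ n)) - v) (ENNReal.ofReal (2 * (σ + 1))) volume)
            atTop (𝓝 0) := by
  obtain ⟨C, hC⟩ := exists_eLpNorm_le_h2Norm (by omega) hσ
  have hmem : ∀ u ∈ H2Radial d, MemLp u (ENNReal.ofReal (2 * (σ + 1))) volume := fun u hu =>
    ⟨Lp.aestronglyMeasurable u,
      (hC u hu.1.ne).trans_lt (ENNReal.mul_lt_top ENNReal.coe_lt_top hu.1)⟩
  refine ⟨⟨C, fun u hu => ⟨hmem u hu, hC u hu.1.ne⟩⟩, fun u hu ⟨M, hM⟩ => ?_⟩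
  have hnorm : ∀ n, ‖u n‖ ≤ M := fun n => by
    rw [Lp.norm_def]
    exact ENNReal.toReal_mono ENNReal.coe_ne_top ((eLpNorm_le_h2Norm _).trans (hM n))
  obtain ⟨φ, hφ, hlim⟩ := exists_subseq_cauchySeq_band hnorm
  have : Fact (1 ≤ ENNReal.ofReal (2 * (σ + 1))) := ⟨by
    rw [← ENNReal.ofReal_one]; exact ENNReal.ofReal_le_ofReal (by linarith [hσ.1])⟩
  -- The `L²` classes are re-read as `L^p` classes, so that completeness of `L^p` supplies the
  -- limit.
  have hcauchy : CauchySeq fun n => (hmem _ (hu (φ n))).toLp (u (φ n)) := by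
    rw [Lp.cauchySeq_Lp_iff_cauchySeq_eLpNorm]
    refine (tendsto_eLpNorm_sub_of_cauchySeq_band hd hσ ENNReal.coe_ne_top
      (fun n => (hu (φ n)).2) (fun n => hM (φ n)) hlim).congr fun n => eLpNorm_congr_ae ?_
    exact ((hmem _ (hu (φ n.1))).coeFn_toLp.sub (hmem _ (hu (φ n.2))).coeFn_toLp).symm
  obtain ⟨v, hv⟩ := cauchySeq_tendsto_of_complete hcauchy
  refine ⟨φ, hφ, v, Lp.memLp v, ?_⟩
  refine ((Lp.tendsto_Lp_iff_tendsto_eLpNorm' _ _).1 hv).congr fun n => eLpNorm_congr_ae ?_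
  exact (hmem _ (hu (φ n))).coeFn_toLp.sub (ae_eq_refl _)
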